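/- Let $f:\mathbb{R}\to\mathbb{R}$ be an odd smooth function that equals its Taylor series at $0$ on all of $\mathbb{R}$, and suppose its derivatives at $0$ are bounded: $|f^{(k)}(0)|\le N$ for all $k$. For $k\ge 0$ put $$F_k(x)=\sum_{u\ge 0}\frac{f^{(2u+k)}(0)}{u!}x^u,\qquad \kappa=\sum_{k\text{ odd}}\frac{F_k(1/2)^2}{k!};$$ these series converge (the first for every real $x$). Let $X\sim\mathcal N(0,\Sigma)$ be a nondegenerate Gaussian vector in $\mathbb{R}^d$ with covariance matrix $\Sigma=(\sigma_{ij})$, and suppose that its precision matrix is $\Sigma^{-1}=I+B$, where $B_{jj}=0$ for all $j$ and the Euclidean operator norm satisfies $\|B\|\le\delta<1$. Let $\epsilon=\delta/(1-\delta)$ and let $\tau=(\tau_{ij})$ be the covariance matrix of $Y=(f(X_1),\dots,f(X_d))$. Then every $Y_i$ is square integrable and $$\tau_{ii}=\kappa\,\sigma_{ii}+O(\epsilon^2)\qquad(1\le i\le d),$$ in the following sense: for every $N$ and every $\delta_0<1$ there is a constant $C$, depending only on $N$ and $\delta_0$ (not on $f$, $d$, $\Sigma$, $B$, $\delta$ or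 $i$), such that $|\tau_{ii}-\kappa\sigma_{ii}|\le C\epsilon^2$ whenever $\delta\le\delta_0$. -/

import Mathlib

open MeasureTheory ProbabilityTheory
open scoped Matrix Nat ContDiff

/-- The summands of the power series `F_k(x) = ∑_{u ≥ 0} f^{(2u+k)}(0) / u! * x^u`. -/
noncomputable def fTerm (f : ℝ → ℝ) (k : ℕ) (x : ℝ) (u : ℕ) : ℝ :=
  iteratedDeriv (2 * u + k) f 0 / (u ! : ℝ) * x ^ u

/-- `F_k(x) = ∑_{u ≥ 0} f^{(2u+k)}(0) / u! * x^u`. -/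
noncomputable def fSeries (f : ℝ → ℝ) (k : ℕ) (x : ℝ) : ℝ :=
  ∑' u : ℕ, fTerm f k x u

/-- The summand `F_k(1/2)^2 / k!` of `κ`. -/
noncomputable def kappaTerm (f : ℝ → ℝ) (k : ℕ) : ℝ :=
  fSeries f k (1 / 2) ^ 2 / (k ! : ℝ)

/-- `κ = ∑_{k odd} F_k(1/2)^2 / k!`. -/
noncomputable def kappa (f : ℝ → ℝ) : ℝ :=
  ∑' k : {k : ℕ // Odd k}, kappaTerm f k

/-- The diagonal transformation `x ↦ (f(x_1), …, f(x_d))` of `ℝ^d`. -/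
noncomputable def diagMap {d : ℕ} (f : ℝ → ℝ) (x : EuclideanSpace ℝ (Fin d)) :
    EuclideanSpace ℝ (Fin d) :=
  WithLp.toLp 2 fun i => f (x i)

/-- The law `π` of `Y = f(X)`, where `X ~ N(0, S)` and `f` acts on each coordinate. -/
noncomputable def transformedLaw {d : ℕ} (f : ℝ → ℝ) (S : Matrix (Fin d) (Fin d) ℝ) :
    Measure (EuclideanSpace ℝ (Fin d)) :=
  (multivariateGaussian 0 S).map (diagMap f)

/-- The covariance matrix `τ` of a law on `ℝ^d`. -/
noncomputable def lawCovariance {d : ℕ} (μ : Measure (EuclideanSpace ℝ (Fin d))) :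
    Matrix (Fin d) (Fin d) ℝ :=
  Matrix.of fun i j => cov[fun y => y i, fun y => y j; μ]

/-- The operator norm of a real matrix for the Euclidean norm. -/
noncomputable def euclideanOpNorm {d : ℕ} (B : Matrix (Fin d) (Fin d) ℝ) : ℝ :=
  ‖Matrix.toEuclideanCLM (n := Fin d) (𝕜 := ℝ) B‖

/-! Since `f` is odd, `Y_i` is centred, so `τ_ii` is the second moment `V(s)` of `f` under `N(0, s)`
with `s = σ_ii`. Squaring the Taylor series and integrating termwise gives `V(s) = ∑ w_n s^n` with
`w_n = wickCoeff a n`, `a_k = f^{(k)}(0)` and `|w_n| ≤ N² 2^n / n!`. Regrouping `∑ w_n` by `k`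
yields `κ = V(1)`: this is Parseval for the Hermite expansion, obtained here from a polynomial
identity (`sum_antidiagonal_mul_eq_wickCoeff`).

Writing `S = 1 - B + B S B` with `B_ii = 0` gives `s = 1 + O(ε²)`. Hence `V(s) - κ s = (V(s) - V(1))
- κ (s - 1)` is `O(|s - 1|)`, with constants independent of `f` and `d`. -/

/-! ### Coefficients of the second moment. -/

/-- The block `∑_{u + v = m} a_{2u+k} a_{2v+k} / (2^m u! v! k!)`. -/
noncomputable def wickBlock (a : ℕ → ℝ) (m k : ℕ) : ℝ :=
  ∑ q ∈ Finset.HasAntidiagonal.antidiagonal m,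
    a (2 * q.1 + k) * a (2 * q.2 + k) / (2 ^ m * (q.1 ! : ℝ) * (q.2 ! : ℝ) * (k ! : ℝ))

/-- The coefficient of `s ^ n` in the second moment of `∑ a_k X ^ k / k!` for `X ~ N(0, s)`. -/
noncomputable def wickCoeff (a : ℕ → ℝ) (n : ℕ) : ℝ :=
  ∑ p ∈ Finset.HasAntidiagonal.antidiagonal n, wickBlock a p.1 p.2

theorem sum_antidiagonal_inv_factorial (n : ℕ) :
    ∑ p ∈ Finset.HasAntidiagonal.antidiagonal n, 1 / ((p.1 ! : ℝ) * (p.2 ! : ℝ)) = 2 ^ n / (n ! : ℝ) := by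
  have h := (Commute.all (1 : ℝ) 1).add_pow' n
  rw [show (1 : ℝ) + 1 = 2 by norm_num] at h
  rw [h, Finset.sum_div]
  refine Finset.sum_congr rfl fun p hp => ?_
  obtain rfl := Finset.HasAntidiagonal.mem_antidiagonal.1 hp
  have h2 : ((p.1 + p.2).choose p.1 : ℝ) * (p.1 ! : ℝ) * (p.2 ! : ℝ) = ((p.1 + p.2)! : ℝ) := by
    rw [Nat.choose_symm_add]
    exact_mod_cast Nat.add_choose_mul_factorial_mul_factorial p.1 p.2
  rw [← h2]
  have : ((p.1 + p.2).choose p.1 : ℝ) ≠ 0 := by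
    exact_mod_cast (Nat.choose_pos (Nat.le_add_right _ _)).ne'
  simp
  field_simp

/-- The binomial sum `∑ 1 / (u! v!) = 2^m / m!` cancels the `2^m` in the denominator. -/
theorem abs_wickBlock_le {a : ℕ → ℝ} {N : ℝ} (ha : ∀ k, |a k| ≤ N) (m k : ℕ) :
    |wickBlock a m k| ≤ N ^ 2 * (1 / ((m ! : ℝ) * (k ! : ℝ))) := by
  calc |wickBlock a m k| ≤ ∑ q ∈ Finset.HasAntidiagonal.antidiagonal m,
        N ^ 2 / (2 ^ m * (k ! : ℝ)) * (1 / ((q.1 ! : ℝ) * (q.2 ! : ℝ))) := by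
        refine (Finset.abs_sum_le_sum_abs _ _).trans (Finset.sum_le_sum fun q _ => ?_)
        rw [abs_div, abs_mul, abs_of_nonneg
          (by positivity : (0 : ℝ) ≤ 2 ^ m * (q.1 ! : ℝ) * (q.2 ! : ℝ) * (k ! : ℝ))]
        calc _ ≤ N * N / (2 ^ m * (q.1 ! : ℝ) * (q.2 ! : ℝ) * (k ! : ℝ)) := by
              gcongr
              · exact (abs_nonneg _).trans (ha 0)
              · exact ha _
              · exact ha _
          _ = _ := by field_simp
    _ = _ := by
        rw [← Finset.mul_sum, sum_antidiagonal_inv_factorial]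
        field_simp

theorem abs_wickCoeff_le {a : ℕ → ℝ} {N : ℝ} (ha : ∀ k, |a k| ≤ N) (n : ℕ) :
    |wickCoeff a n| ≤ N ^ 2 * (2 ^ n / (n ! : ℝ)) := by
  rw [← sum_antidiagonal_inv_factorial, Finset.mul_sum]
  exact (Finset.abs_sum_le_sum_abs _ _).trans
    (Finset.sum_le_sum fun p _ => abs_wickBlock_le ha p.1 p.2)

theorem hasSum_pow_div_factorial (x : ℝ) :
    HasSum (fun n : ℕ => x ^ n / (n ! : ℝ)) (Real.exp x) := by
  rw [Real.exp_eq_exp_ℝ]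
  exact NormedSpace.expSeries_div_hasSum_exp x

theorem summable_wickBlock {a : ℕ → ℝ} {N : ℝ} (ha : ∀ k, |a k| ≤ N) :
    Summable fun p : ℕ × ℕ => wickBlock a p.1 p.2 := by
  have h1 : Summable fun n : ℕ => 1 / (n ! : ℝ) := by
    simpa using (hasSum_pow_div_factorial 1).summable
  have h2 := (h1.mul_of_nonneg h1 (fun n => by positivity) (fun n => by positivity)).mul_left (N ^ 2)
  refine Summable.of_norm_bounded h2 fun p => ?_
  refine (abs_wickBlock_le ha p.1 p.2).trans (le_of_eq ?_)
  field_simp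

/-- Both sides are images of `(X + Y) ^ (2n) = (X ^ 2 + Y ^ 2 + 2XY) ^ n` under the linear
functional `X ^ i * Y ^ j ↦ a_i a_j`. -/
theorem sum_antidiagonal_mul_eq_wickCoeff (a : ℕ → ℝ) (n : ℕ) :
    (∑ p ∈ Finset.HasAntidiagonal.antidiagonal (2 * n),
      a p.1 / (p.1 ! : ℝ) * (a p.2 / (p.2 ! : ℝ))) *
      (((2 * n)! : ℝ) / (2 ^ n * (n ! : ℝ))) = wickCoeff a n := by
  set X : MvPolynomial (Fin 2) ℝ := MvPolynomial.X 0 with hX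
  set Y : MvPolynomial (Fin 2) ℝ := MvPolynomial.X 1 with hY
  obtain ⟨Φ, hΦ⟩ : ∃ Φ : MvPolynomial (Fin 2) ℝ →ₗ[ℝ] ℝ, ∀ i j, Φ (X ^ i * Y ^ j) = a i * a j := by
    refine ⟨(MvPolynomial.basisMonomials (Fin 2) ℝ).constr ℝ fun m => a (m 0) * a (m 1),
      fun i j => ?_⟩
    have : X ^ i * Y ^ j = MvPolynomial.basisMonomials (Fin 2) ℝ
        (Finsupp.single 0 i + Finsupp.single 1 j) := by
      simp [hX, hY, MvPolynomial.X_pow_eq_monomial, MvPolynomial.monomial_mul]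
    rw [this, Module.Basis.constr_basis]
    simp
  have hchoose : ∀ i j : ℕ, ((i + j).choose i : ℝ) * (i ! : ℝ) * (j ! : ℝ) = ((i + j)! : ℝ) :=
    fun i j => by
      rw [Nat.choose_symm_add]
      exact_mod_cast Nat.add_choose_mul_factorial_mul_factorial i j
  have h1 : Φ ((X + Y) ^ (2 * n)) = ((2 * n)! : ℝ) *
      ∑ p ∈ Finset.HasAntidiagonal.antidiagonal (2 * n),
      a p.1 / (p.1 ! : ℝ) * (a p.2 / (p.2 ! : ℝ)) := by
    rw [(Commute.all X Y).add_pow', map_sum, Finset.mul_sum]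
    refine Finset.sum_congr rfl fun p hp => ?_
    rw [map_nsmul, hΦ, ← Finset.HasAntidiagonal.mem_antidiagonal.1 hp, ← hchoose, nsmul_eq_mul]
    field_simp
  have h2 : Φ ((X + Y) ^ (2 * n)) = (2 ^ n * (n ! : ℝ)) * wickCoeff a n := by
    -- With `m` factors `X² + Y²` and `k = n - m` factors `2XY`, the power `2^k = 2^n / 2^m`
    -- accounts for the `1 / 2^m` in the block.
    rw [pow_mul, show (X + Y) ^ 2 = (X ^ 2 + Y ^ 2) + (2 : ℝ) • (X * Y) by
      rw [two_smul]; ring, (Commute.all (X ^ 2 + Y ^ 2) _).add_pow', map_sum, wickCoeff,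
      Finset.mul_sum]
    refine Finset.sum_congr rfl fun p hp => ?_
    rw [(Commute.all (X ^ 2) (Y ^ 2)).add_pow', map_nsmul, Finset.sum_mul, map_sum, wickBlock,
      ← Finset.HasAntidiagonal.mem_antidiagonal.1 hp, Finset.mul_sum, Finset.smul_sum]
    refine Finset.sum_congr rfl fun q hq => ?_
    rw [show ((p.1.choose q.1) • ((X ^ 2) ^ q.1 * (Y ^ 2) ^ q.2)) * ((2 : ℝ) • (X * Y)) ^ p.2 =
      (p.1.choose q.1) • (2 : ℝ) ^ p.2 • (X ^ (2 * q.1 + p.2) * Y ^ (2 * q.2 + p.2)) by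
        rw [smul_pow, smul_mul_assoc, mul_smul_comm]; congr 2; ring]
    rw [map_nsmul, map_smul, hΦ, nsmul_eq_mul, nsmul_eq_mul, smul_eq_mul, ← hchoose p.1 p.2]
    rw [← Finset.HasAntidiagonal.mem_antidiagonal.1 hq, ← hchoose q.1 q.2]
    field_simp
    ring
  rw [h1] at h2
  rw [mul_div_assoc', div_eq_iff (by positivity), mul_comm, h2, mul_comm]

theorem summable_taylor {a : ℕ → ℝ} {N : ℝ} (ha : ∀ k, |a k| ≤ N) (s : ℕ → ℕ) (x : ℝ) :
    Summable fun u : ℕ => ‖a (s u) / (u ! : ℝ) * x ^ u‖ := by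
  refine Summable.of_nonneg_of_le (fun _ => norm_nonneg _) (fun u => ?_)
    ((hasSum_pow_div_factorial |x|).summable.mul_left N)
  rw [Real.norm_eq_abs, abs_mul, abs_div, abs_pow, Nat.abs_cast]
  calc _ ≤ N / (u ! : ℝ) * |x| ^ u := by gcongr; exact ha _
    _ = _ := by ring

/-! ### The series for `κ` and for `f²`. -/

section

variable {f : ℝ → ℝ} {N : ℝ}

theorem summable_fTerm (ha : ∀ k, |iteratedDeriv k f 0| ≤ N) (k : ℕ) (x : ℝ) :
    Summable (fTerm f k x) :=
  (summable_taylor ha (fun u => 2 * u + k) x).of_norm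

/-- Cauchy product of `F_k(1/2)` with itself; `(1/2)^u (1/2)^v` supplies `1 / 2^m`. -/
theorem hasSum_wickBlock (ha : ∀ k, |iteratedDeriv k f 0| ≤ N) (k : ℕ) :
    HasSum (fun m => wickBlock (fun j => iteratedDeriv j f 0) m k) (kappaTerm f k) := by
  have hs := summable_taylor ha (fun u => 2 * u + k) (1 / 2)
  have h := (summable_norm_sum_mul_antidiagonal_of_summable_norm hs hs).of_norm.hasSum
  rw [← tsum_mul_tsum_eq_tsum_sum_antidiagonal_of_summable_norm hs hs] at h
  have h' := h.div_const (k ! : ℝ)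
  rw [← pow_two] at h'
  refine h'.congr_fun ?_
  intro m
  rw [wickBlock, Finset.sum_div]
  refine Finset.sum_congr rfl fun q hq => ?_
  rw [← Finset.HasAntidiagonal.mem_antidiagonal.1 hq, pow_add, one_div, inv_pow, inv_pow]
  field_simp

/-- One absolutely summable double family, summed over `m` for fixed `k` or along `m + k = n`. -/
theorem hasSum_kappaTerm (ha : ∀ k, |iteratedDeriv k f 0| ≤ N) :
    HasSum (kappaTerm f) (∑' n, wickCoeff (fun j => iteratedDeriv j f 0) n) := by
  have hs := summable_wickBlock ha
  have h1 := hs.prod_symm.hasSum.prod_fiberwise (fun k => hasSum_wickBlock ha k)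
  have h2 : HasSum (fun n => wickCoeff (fun j => iteratedDeriv j f 0) n)
      (∑' p : ℕ × ℕ, wickBlock (fun j => iteratedDeriv j f 0) p.1 p.2) := by
    have h3 := (Finset.HasAntidiagonal.sigmaAntidiagonalEquivProd (A := ℕ)).hasSum_iff.2 hs.hasSum
    have h4 := h3.sigma (fun n => hasSum_fintype _)
    refine h4.congr_fun ?_
    intro n
    exact (Finset.sum_coe_sort _ (fun p : ℕ × ℕ => wickBlock _ p.1 p.2)).symm
  rw [h2.tsum_eq]
  convert h1 using 1
  exact ((Equiv.prodComm ℕ ℕ).tsum_eq _).symm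

theorem iteratedDeriv_eq_zero_of_odd (hf : Function.Odd f) {k : ℕ} (hk : Even k) :
    iteratedDeriv k f 0 = 0 := by
  have h := iteratedDeriv_comp_neg k f 0
  rw [show (fun x => f (-x)) = fun x => -f x from funext hf] at h
  simp [hk.neg_one_pow, iteratedDeriv_fun_neg] at h
  linarith

theorem kappaTerm_eq_zero_of_even (hf : Function.Odd f) {k : ℕ} (hk : Even k) :
    kappaTerm f k = 0 := by
  have : fTerm f k (1 / 2) = 0 := by
    ext u
    simp [fTerm, iteratedDeriv_eq_zero_of_odd hf (Even.add (even_two_mul u) hk)]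
  rw [kappaTerm, fSeries, this]
  simp

theorem hasSum_kappaTerm_odd (hf : Function.Odd f) (ha : ∀ k, |iteratedDeriv k f 0| ≤ N) :
    HasSum (fun k : {k : ℕ // Odd k} => kappaTerm f k)
      (∑' n, wickCoeff (fun j => iteratedDeriv j f 0) n) := by
  refine (hasSum_subtype_iff_of_support_subset (s := {k : ℕ | Odd k}) fun k hk => ?_).2
    (hasSum_kappaTerm ha)
  by_contra hne
  exact hk (kappaTerm_eq_zero_of_even hf (Nat.not_odd_iff_even.1 hne))

theorem hasSum_sq (hf : Function.Odd f) (ha : ∀ k, |iteratedDeriv k f 0| ≤ N)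
    (ht : ∀ x : ℝ, HasSum (fun k : ℕ => iteratedDeriv k f 0 / (k ! : ℝ) * x ^ k) (f x)) (x : ℝ) :
    HasSum (fun n : ℕ => (∑ p ∈ Finset.HasAntidiagonal.antidiagonal (2 * n),
      iteratedDeriv p.1 f 0 / (p.1 ! : ℝ) *
      (iteratedDeriv p.2 f 0 / (p.2 ! : ℝ))) * x ^ (2 * n)) (f x ^ 2) := by
  have hs := summable_taylor ha id x
  have h := (summable_norm_sum_mul_antidiagonal_of_summable_norm hs hs).of_norm.hasSum
  rw [← tsum_mul_tsum_eq_tsum_sum_antidiagonal_of_summable_norm hs hs] at h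
  simp only [id, (ht x).tsum_eq, ← pow_two] at h
  -- Only even degrees survive: in an odd degree one of the two indices is even, and that derivative
  -- vanishes.
  have hinj : Function.Injective fun n : ℕ => 2 * n := fun m n h => by simpa using h
  refine ((hinj.hasSum_iff fun m hm => ?_).2 h).congr_fun ?_
  · refine Finset.sum_eq_zero fun p hp => ?_
    have hp' := Finset.HasAntidiagonal.mem_antidiagonal.1 hp
    rcases Nat.even_or_odd p.1 with h1 | h1
    · simp [iteratedDeriv_eq_zero_of_odd hf h1]
    rcases Nat.even_or_odd p.2 with h2 | h2
    · simp [iteratedDeriv_eq_zero_of_odd hf h2]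
    · obtain ⟨r, hr⟩ := hp' ▸ h1.add_odd h2
      exact absurd ⟨r, by simp only; omega⟩ hm
  · intro n
    simp only [Function.comp]
    rw [Finset.sum_mul]
    refine Finset.sum_congr rfl fun p hp => ?_
    rw [← Finset.HasAntidiagonal.mem_antidiagonal.1 hp, pow_add]
    ring

end

/-! ### Gaussian moments and termwise integration. -/

theorem integral_even_pow_gaussianReal {v : NNReal} (hv : v ≠ 0) (n : ℕ) :
    ∫ x, x ^ (2 * n) ∂gaussianReal 0 v =
      ((2 * n)! : ℝ) / (2 ^ n * (n ! : ℝ)) * (v : ℝ) ^ n := by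
  have hv' : (0 : ℝ) < v := by exact_mod_cast hv.bot_lt
  rw [integral_gaussianReal_eq_integral_smul hv]
  have h1 : ∀ x : ℝ, gaussianPDFReal 0 v x • x ^ (2 * n) = (√(2 * Real.pi * v))⁻¹ *
      (fun y : ℝ => y ^ (2 * (n : ℝ)) * Real.exp (-(1 / (2 * v)) * y ^ (2 : ℝ))) |x| := by
    intro x
    have : |x| ^ (2 * (n : ℝ)) = x ^ (2 * n) := by
      rw [show (2 * (n : ℝ)) = ((2 * n : ℕ) : ℝ) by push_cast; ring, Real.rpow_natCast, pow_mul,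
        sq_abs, ← pow_mul]
    simp only [gaussianPDFReal, smul_eq_mul, this, Real.rpow_two, sq_abs]
    rw [show -(x - 0) ^ 2 / (2 * (v : ℝ)) = -(1 / (2 * v)) * x ^ 2 by ring]
    ring
  rw [integral_congr_ae (.of_forall h1), integral_const_mul, integral_comp_abs
      (f := fun y : ℝ => y ^ (2 * (n : ℝ)) * Real.exp (-(1 / (2 * v)) * y ^ (2 : ℝ))),
    integral_rpow_mul_exp_neg_mul_rpow (by norm_num)
    (by linarith [(Nat.cast_nonneg n : (0 : ℝ) ≤ n)]) (by positivity),
    show (2 * (n : ℝ) + 1) / 2 = n + 1 / 2 by ring, Real.Gamma_nat_add_half,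
    show -(2 * (n : ℝ) + 1) / 2 = -(n + 1 / 2) by ring, one_div, Real.inv_rpow (by positivity),
    Real.rpow_neg (by positivity), inv_inv, Real.rpow_add (by positivity), Real.rpow_natCast,
    inv_eq_one_div, ← Real.sqrt_eq_rpow, Real.sqrt_mul (by positivity),
    Real.sqrt_mul (by positivity), Real.sqrt_mul (by positivity)]
  have h2 : ((2 * n)! : ℝ) = ((2 * n - 1)‼ : ℝ) * (2 ^ n * (n ! : ℝ)) := by
    rcases n with _ | n
    · simp
    · have := Nat.factorial_eq_mul_doubleFactorial (2 * n + 1)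
      rw [show 2 * n + 1 + 1 = 2 * (n + 1) by ring, Nat.doubleFactorial_two_mul] at this
      rw [this, show 2 * (n + 1) - 1 = 2 * n + 1 by omega]
      push_cast
      ring
  rw [h2]
  have : (0 : ℝ) < √2 := by positivity
  have : (0 : ℝ) < √Real.pi := by positivity
  have : (0 : ℝ) < √v := by positivity
  field_simp
  rw [mul_pow]

theorem integrable_pow_gaussianReal (v : NNReal) (n : ℕ) :
    Integrable (fun x : ℝ => x ^ n) (gaussianReal 0 v) := by
  refine (integrable_norm_iff (by fun_prop)).1 ?_
  simpa only [norm_pow, id] using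
    (memLp_id_gaussianReal (μ := 0) (v := v) n).integrable_norm_pow'

section

variable {f : ℝ → ℝ} {N : ℝ}

theorem abs_le_mul_exp_abs (ha : ∀ k, |iteratedDeriv k f 0| ≤ N)
    (ht : ∀ x : ℝ, HasSum (fun k : ℕ => iteratedDeriv k f 0 / (k ! : ℝ) * x ^ k) (f x)) (x : ℝ) :
    |f x| ≤ N * Real.exp |x| := by
  rw [← (ht x).tsum_eq, ← Real.norm_eq_abs]
  refine tsum_of_norm_bounded ((hasSum_pow_div_factorial |x|).mul_left N) fun u => ?_
  rw [Real.norm_eq_abs, abs_mul, abs_div, abs_pow, Nat.abs_cast]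
  calc _ ≤ N / (u ! : ℝ) * |x| ^ u := by gcongr; exact ha _
    _ = _ := by ring

theorem integrable_sq_gaussianReal (hc : Continuous f) (ha : ∀ k, |iteratedDeriv k f 0| ≤ N)
    (ht : ∀ x : ℝ, HasSum (fun k : ℕ => iteratedDeriv k f 0 / (k ! : ℝ) * x ^ k) (f x))
    (v : NNReal) : Integrable (fun x => f x ^ 2) (gaussianReal 0 v) := by
  have h := ((integrable_exp_mul_gaussianReal (μ := 0) (v := v) 2).add
    (integrable_exp_mul_gaussianReal (μ := 0) (v := v) (-2))).const_mul (N ^ 2)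
  refine h.mono' (hc.pow 2).aestronglyMeasurable (Filter.Eventually.of_forall fun x => ?_)
  have h1 : f x ^ 2 ≤ (N * Real.exp |x|) ^ 2 := by
    rw [← sq_abs]
    exact pow_le_pow_left₀ (abs_nonneg _) (abs_le_mul_exp_abs ha ht x) 2
  have h2 : Real.exp |x| ^ 2 ≤ Real.exp (2 * x) + Real.exp (-2 * x) := by
    rw [← Real.exp_nat_mul]
    rcases abs_cases x with ⟨h, -⟩ | ⟨h, -⟩ <;> rw [h]
    · simpa using (Real.exp_pos _).le
    · simpa using (Real.exp_pos _).le
  rw [Real.norm_of_nonneg (sq_nonneg _)]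
  calc _ ≤ _ := h1
    _ = N ^ 2 * Real.exp |x| ^ 2 := by ring
    _ ≤ N ^ 2 * _ := mul_le_mul_of_nonneg_left h2 (sq_nonneg _)

theorem integral_gaussianReal_eq_zero_of_odd (hf : Function.Odd f) (v : NNReal) :
    ∫ x, f x ∂gaussianReal 0 v = 0 := by
  have h : ∫ x, f x ∂gaussianReal 0 v = ∫ x, f (-x) ∂gaussianReal 0 v := by
    conv_lhs => rw [← neg_zero, ← gaussianReal_map_neg]
    exact integral_map_equiv (MeasurableEquiv.neg ℝ) f
  simp only [hf _, integral_neg] at h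
  linarith

/-- Even powers are nonnegative, so the `L¹` norm of the `n`-th term is exactly `|w_n| v^n`,
dominated by the series of `N² exp(2v)`; this permits termwise integration. -/
theorem hasSum_integral_sq_gaussianReal (hf : Function.Odd f)
    (ha : ∀ k, |iteratedDeriv k f 0| ≤ N)
    (ht : ∀ x : ℝ, HasSum (fun k : ℕ => iteratedDeriv k f 0 / (k ! : ℝ) * x ^ k) (f x))
    {v : NNReal} (hv : v ≠ 0) :
    HasSum (fun n => wickCoeff (fun j => iteratedDeriv j f 0) n * (v : ℝ) ^ n)
      (∫ x, f x ^ 2 ∂gaussianReal 0 v) := by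
  set c : ℕ → ℝ := fun n => ∑ p ∈ Finset.HasAntidiagonal.antidiagonal (2 * n),
    iteratedDeriv p.1 f 0 / (p.1 ! : ℝ) * (iteratedDeriv p.2 f 0 / (p.2 ! : ℝ)) with hc
  have hcw : ∀ n, c n * (((2 * n)! : ℝ) / (2 ^ n * (n ! : ℝ)) * (v : ℝ) ^ n) =
      wickCoeff (fun j => iteratedDeriv j f 0) n * (v : ℝ) ^ n := fun n => by
    rw [← sum_antidiagonal_mul_eq_wickCoeff, mul_assoc]
  have hnorm : ∀ n, ∫ x, ‖c n * x ^ (2 * n)‖ ∂gaussianReal 0 v =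
      |wickCoeff (fun j => iteratedDeriv j f 0) n * (v : ℝ) ^ n| := fun n => by
    have : ∀ x : ℝ, ‖c n * x ^ (2 * n)‖ = |c n| * x ^ (2 * n) := fun x => by
      rw [Real.norm_eq_abs, abs_mul, abs_of_nonneg ((even_two_mul n).pow_nonneg x)]
    simp_rw [this]
    rw [integral_const_mul, integral_even_pow_gaussianReal hv, ← hcw, abs_mul (c n),
      abs_of_nonneg (by positivity :
        0 ≤ ((2 * n)! : ℝ) / (2 ^ n * (n ! : ℝ)) * (v : ℝ) ^ n)]
  have h := hasSum_integral_of_summable_integral_norm (μ := gaussianReal 0 v)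
    (F := fun n x => c n * x ^ (2 * n))
    (fun n => (integrable_pow_gaussianReal v (2 * n)).const_mul _) ?_
  · have h1 : ∀ x, ∑' n, c n * x ^ (2 * n) = f x ^ 2 := fun x => (hasSum_sq hf ha ht x).tsum_eq
    simp only [h1] at h
    refine h.congr_fun fun n => ?_
    rw [integral_const_mul, integral_even_pow_gaussianReal hv, hcw]
  · simp_rw [hnorm]
    refine Summable.of_nonneg_of_le (fun _ => abs_nonneg _) (fun n => ?_)
      ((hasSum_pow_div_factorial (2 * (v : ℝ))).summable.mul_left (N ^ 2))
    rw [abs_mul, abs_of_nonneg (by positivity : 0 ≤ (v : ℝ) ^ n), mul_pow]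
    calc _ ≤ N ^ 2 * (2 ^ n / (n ! : ℝ)) * (v : ℝ) ^ n := by
          gcongr
          exact abs_wickCoeff_le ha n
      _ = _ := by ring

end

/-- A power series with coefficients `O(2 ^ n / n!)` has a linear modulus of continuity at `1`. -/
theorem abs_sub_le_of_hasSum {g : ℕ → ℝ} {K M s V W : ℝ}
    (hg : ∀ n, |g n| ≤ K * (2 ^ n / (n ! : ℝ))) (hM : 1 ≤ M) (hs0 : 0 ≤ s) (hsM : s ≤ M)
    (hV : HasSum (fun n => g n * s ^ n) V) (hW : HasSum g W) :
    |V - W| ≤ K * Real.exp (4 * M) * |s - 1| := by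
  have hK : 0 ≤ K := by simpa using (abs_nonneg _).trans (hg 0)
  have h := hV.sub hW
  rw [← h.tsum_eq, ← Real.norm_eq_abs]
  refine tsum_of_norm_bounded
    (((hasSum_pow_div_factorial (4 * M)).mul_left K).mul_right |s - 1|) fun n => ?_
  -- The factor `n` from the difference of powers is absorbed by `n ≤ 2^n`, whence `4M` in the
  -- exponent.
  have h1 : |s ^ n - 1| ≤ |s - 1| * (2 * M) ^ n := by
    have h2 := abs_pow_sub_pow_le s 1 n
    rw [one_pow, abs_one, abs_of_nonneg hs0] at h2
    refine h2.trans ?_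
    rw [mul_assoc, mul_pow]
    gcongr
    · exact_mod_cast Nat.lt_two_pow_self.le
    · calc max s 1 ^ (n - 1) ≤ M ^ (n - 1) :=
            pow_le_pow_left₀ (hs0.trans (le_max_left _ _)) (max_le hsM hM) _
        _ ≤ M ^ n := pow_le_pow_right₀ hM (Nat.sub_le _ _)
  rw [show g n * s ^ n - g n = g n * (s ^ n - 1) by ring, Real.norm_eq_abs, abs_mul]
  calc _ ≤ K * (2 ^ n / (n ! : ℝ)) * (|s - 1| * (2 * M) ^ n) := by
        gcongr
        exact hg n
    _ = _ := by
        rw [show (4 * M) = 2 * (2 * M) by ring, mul_pow 2 (2 * M)]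
        ring

/-! ### Operator norm and the diagonal of the covariance. -/

theorem euclideanOpNorm_one_le {d : ℕ} : euclideanOpNorm (1 : Matrix (Fin d) (Fin d) ℝ) ≤ 1 := by
  rw [euclideanOpNorm, map_one]
  exact ContinuousLinearMap.norm_id_le

theorem euclideanOpNorm_mul_le {d : ℕ} (A B : Matrix (Fin d) (Fin d) ℝ) :
    euclideanOpNorm (A * B) ≤ euclideanOpNorm A * euclideanOpNorm B := by
  rw [euclideanOpNorm, map_mul]
  exact norm_mul_le _ _

theorem euclideanOpNorm_sub_le {d : ℕ} (A B : Matrix (Fin d) (Fin d) ℝ) :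
    euclideanOpNorm (A - B) ≤ euclideanOpNorm A + euclideanOpNorm B := by
  rw [euclideanOpNorm, map_sub]
  exact norm_sub_le _ _

theorem euclideanOpNorm_nonneg {d : ℕ} (A : Matrix (Fin d) (Fin d) ℝ) : 0 ≤ euclideanOpNorm A :=
  norm_nonneg _

theorem abs_apply_self_le_euclideanOpNorm {d : ℕ} (A : Matrix (Fin d) (Fin d) ℝ) (i : Fin d) :
    |A i i| ≤ euclideanOpNorm A := by
  have h1 := (Matrix.toEuclideanCLM (n := Fin d) (𝕜 := ℝ) A).le_opNorm (EuclideanSpace.single i 1)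
  have h2 := PiLp.norm_apply_le
    (Matrix.toEuclideanCLM (n := Fin d) (𝕜 := ℝ) A (EuclideanSpace.single i 1)) i
  have h3 : (Matrix.toEuclideanCLM (n := Fin d) (𝕜 := ℝ) A (EuclideanSpace.single i 1)) i =
      A i i := by
    simp [Matrix.ofLp_toEuclideanCLM]
  have h4 : ‖(EuclideanSpace.single i 1 : EuclideanSpace ℝ (Fin d))‖ = 1 := by simp
  rw [h3] at h2
  rw [h4, mul_one] at h1
  exact h2.trans h1

section

variable {d : ℕ} {S B : Matrix (Fin d) (Fin d) ℝ} {δ : ℝ}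

/-- From `S = 1 - B S`, `‖S‖ ≤ 1 + δ ‖S‖`. -/
theorem euclideanOpNorm_le_of_mul_eq_one (h : (1 + B) * S = 1) (hB : euclideanOpNorm B ≤ δ)
    (hδ : δ < 1) : euclideanOpNorm S ≤ 1 / (1 - δ) := by
  have h1 : S = 1 - B * S := by rw [← h]; noncomm_ring
  have h2 : euclideanOpNorm S ≤ 1 + δ * euclideanOpNorm S := by
    calc euclideanOpNorm S = euclideanOpNorm (1 - B * S) := by rw [← h1]
      _ ≤ _ := euclideanOpNorm_sub_le _ _
      _ ≤ 1 + euclideanOpNorm B * euclideanOpNorm S :=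
        add_le_add euclideanOpNorm_one_le (euclideanOpNorm_mul_le _ _)
      _ ≤ _ := by
        gcongr
        exact euclideanOpNorm_nonneg S
  rw [le_div_iff₀ (by linarith)]
  linarith

/-- Two resolvent steps give `S = 1 - B + B S B`; the linear term has zero diagonal, so the error is
quadratic. -/
theorem abs_apply_self_sub_one_le (h : (1 + B) * S = 1) (hB : euclideanOpNorm B ≤ δ)
    (hδ : δ < 1) {i : Fin d} (hi : B i i = 0) : |S i i - 1| ≤ (δ / (1 - δ)) ^ 2 := by
  have h' : S * (1 + B) = 1 := mul_eq_one_comm.1 h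
  have hδ0 : 0 ≤ δ := (euclideanOpNorm_nonneg B).trans hB
  have h1 : S = 1 - B + B * S * B := by
    have e1 : S = 1 - B * S := by rw [← h]; noncomm_ring
    have e2 : S * B = 1 - S := by rw [← h']; noncomm_ring
    rw [mul_assoc, e2, mul_sub, mul_one]
    nth_rw 1 [e1]
    abel
  have h2 : S i i - 1 = (B * S * B) i i := by
    nth_rw 1 [h1]
    simp [hi]
  rw [h2]
  have hpos : 0 < 1 - δ := by linarith
  calc _ ≤ euclideanOpNorm (B * S * B) := abs_apply_self_le_euclideanOpNorm _ i
    _ ≤ euclideanOpNorm B * euclideanOpNorm S * euclideanOpNorm B :=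
      (euclideanOpNorm_mul_le _ _).trans (mul_le_mul_of_nonneg_right
        (euclideanOpNorm_mul_le _ _) (euclideanOpNorm_nonneg _))
    _ ≤ δ * (1 / (1 - δ)) * δ := by
      have := euclideanOpNorm_le_of_mul_eq_one h hB hδ
      have := euclideanOpNorm_nonneg S
      have := euclideanOpNorm_nonneg B
      gcongr
    _ = δ ^ 2 / (1 - δ) := by ring
    _ ≤ δ ^ 2 / (1 - δ) ^ 2 := by
      gcongr
      nlinarith
    _ = _ := by rw [div_pow]

end

/-! ### Reduction to the one-dimensional marginal. -/

section

variable {d : ℕ} {f : ℝ → ℝ} {S : Matrix (Fin d) (Fin d) ℝ}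

theorem measurable_diagMap (hc : Continuous f) : Measurable (diagMap (d := d) f) := by
  unfold diagMap
  have := hc.measurable
  fun_prop

theorem memLp_transformedLaw (hc : Continuous f) (hS : S.PosSemidef) (i : Fin d)
    (hi : Integrable (fun x => f x ^ 2) (gaussianReal 0 (S i i).toNNReal)) :
    MemLp (fun y : EuclideanSpace ℝ (Fin d) => y i) 2 (transformedLaw f S) := by
  have hp := measurePreserving_eval_multivariateGaussian (μ := 0) hS (i := i)
  rw [transformedLaw, memLp_map_measure_iff (by fun_prop) (measurable_diagMap hc).aemeasurable]
  exact ((memLp_two_iff_integrable_sq hc.aestronglyMeasurable).2 hi).comp_measurePreserving hp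

theorem lawCovariance_transformedLaw_self (hc : Continuous f) (hf : Function.Odd f)
    (hS : S.PosSemidef) (i : Fin d) :
    lawCovariance (transformedLaw f S) i i =
      ∫ x, f x ^ 2 ∂gaussianReal 0 (S i i).toNNReal := by
  have hp := measurePreserving_eval_multivariateGaussian (μ := 0) hS (i := i)
  have hX : AEMeasurable (fun y : EuclideanSpace ℝ (Fin d) => y i) (transformedLaw f S) := by
    fun_prop
  rw [lawCovariance, Matrix.of_apply, covariance_self hX, transformedLaw,
    variance_map (by fun_prop) (measurable_diagMap hc).aemeasurable]
  have hcomp : (fun y : EuclideanSpace ℝ (Fin d) => y i) ∘ diagMap f =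
    f ∘ fun y : EuclideanSpace ℝ (Fin d) => y i := rfl
  rw [hcomp, ← variance_map (by rw [hp.map_eq]; exact hc.aemeasurable) hp.measurable.aemeasurable,
    hp.map_eq]
  exact variance_of_integral_eq_zero hc.aemeasurable (integral_gaussianReal_eq_zero_of_odd hf _)

end

/-! ### The main estimate. -/

theorem mainTheorem5 (N δ₀ : ℝ) (hδ₀ : δ₀ < 1) :
    ∃ C : ℝ, ∀ f : ℝ → ℝ,
      ContDiff ℝ ∞ f →
      (∀ x : ℝ, HasSum (fun k : ℕ => iteratedDeriv k f 0 / (k ! : ℝ) * x ^ k) (f x)) →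
      Function.Odd f →
      (∀ k : ℕ, |iteratedDeriv k f 0| ≤ N) →
      (∀ (k : ℕ) (x : ℝ), Summable (fTerm f k x)) ∧
      Summable (fun k : {k : ℕ // Odd k} => kappaTerm f k) ∧
      ∀ (d : ℕ) (S B : Matrix (Fin d) (Fin d) ℝ) (δ : ℝ),
        S.PosDef →
        S⁻¹ = 1 + B →
        (∀ j : Fin d, B j j = 0) →
        euclideanOpNorm B ≤ δ →
        δ ≤ δ₀ →
        ∀ i : Fin d,
          MemLp (fun y : EuclideanSpace ℝ (Fin d) => y i) 2 (transformedLaw f S) ∧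
          |lawCovariance (transformedLaw f S) i i - kappa f * S i i|
            ≤ C * (δ / (1 - δ)) ^ 2 := by
  -- The first summand bounds `|V(s) - V(1)| / |s - 1|` for `s ≤ 1 / (1 - δ₀)`; the second bounds
  -- `|κ|`.
  refine ⟨N ^ 2 * Real.exp (4 * (1 / (1 - δ₀))) + N ^ 2 * Real.exp 2, fun f hsm ht hf ha =>
    ⟨summable_fTerm ha, (hasSum_kappaTerm_odd hf ha).summable,
      fun d S B δ hS hSB hB hBδ hδ i => ?_⟩⟩
  have hc := hsm.continuous
  refine ⟨memLp_transformedLaw hc hS.posSemidef i (integrable_sq_gaussianReal hc ha ht _), ?_⟩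
  have hSpos : 0 < S i i := hS.diag_pos
  have hmul : (1 + B) * S = 1 := by
    rw [← hSB]
    exact Matrix.nonsing_inv_mul S ((Matrix.isUnit_iff_isUnit_det S).1 hS.isUnit)
  have hδ1 : δ < 1 := hδ.trans_lt hδ₀
  have hδ0 : 0 ≤ δ := (euclideanOpNorm_nonneg B).trans hBδ
  have hs1 := abs_apply_self_sub_one_le hmul hBδ hδ1 (hB i)
  have hsM : S i i ≤ 1 / (1 - δ₀) := calc
    S i i ≤ |S i i| := le_abs_self _
    _ ≤ euclideanOpNorm S := abs_apply_self_le_euclideanOpNorm S i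
    _ ≤ 1 / (1 - δ) := euclideanOpNorm_le_of_mul_eq_one hmul hBδ hδ1
    _ ≤ 1 / (1 - δ₀) := by
      have : 0 < 1 - δ₀ := by linarith
      gcongr
  have hM : 1 ≤ 1 / (1 - δ₀) := by
    rw [le_div_iff₀ (by linarith)]
    linarith
  have hbd := abs_wickCoeff_le ha
  have hV := hasSum_integral_sq_gaussianReal hf ha ht (v := (S i i).toNNReal)
    (by simpa using hSpos)
  rw [Real.coe_toNNReal _ hSpos.le] at hV
  have hexp := (hasSum_pow_div_factorial 2).mul_left (N ^ 2)
  have hκ : kappa f = ∑' n, wickCoeff (fun j => iteratedDeriv j f 0) n :=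
    (hasSum_kappaTerm_odd hf ha).tsum_eq
  have hW : HasSum (wickCoeff fun j => iteratedDeriv j f 0) (kappa f) := by
    rw [hκ]
    exact (Summable.of_norm_bounded hexp.summable hbd).hasSum
  have hκle : |kappa f| ≤ N ^ 2 * Real.exp 2 := by
    rw [hκ, ← Real.norm_eq_abs]
    exact tsum_of_norm_bounded hexp hbd
  have hdiff := abs_sub_le_of_hasSum hbd hM hSpos.le hsM hV hW
  rw [lawCovariance_transformedLaw_self hc hf hS.posSemidef]
  set V := ∫ x, f x ^ 2 ∂gaussianReal 0 (S i i).toNNReal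
  calc |V - kappa f * S i i| = |(V - kappa f) - kappa f * (S i i - 1)| := by ring_nf
    _ ≤ |V - kappa f| + |kappa f| * |S i i - 1| := by
      rw [← abs_mul]
      exact abs_sub _ _
    _ ≤ N ^ 2 * Real.exp (4 * (1 / (1 - δ₀))) * |S i i - 1| +
        N ^ 2 * Real.exp 2 * |S i i - 1| := by gcongr
    _ = (N ^ 2 * Real.exp (4 * (1 / (1 - δ₀))) + N ^ 2 * Real.exp 2) * |S i i - 1| := by ring
    _ ≤ _ := by gcongr
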